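/- Let $D=2^{<\omega}$ be the set of finite binary sequences with the discrete topology, and let $\beta D$ be its Čech–Stone compactification, with $D\subseteq\beta D$ and $D^*=\beta D\setminus D$. Let $cD=D\cup 2^\omega$ be the compactification of $D$ in which the points of $D$ are isolated and each $x\in 2^\omega$ has the sets $U(x,n)=\{s\in cD: x\restriction n\subseteq s\}$, $n\in\omega$, as a local base. Let $e:\beta D\to cD$ be the continuous extension of the identity map of $D$, and for $x\in2^\omega$ put $K_x=\{u\in D^*: e(u)=x\}$. Let $\mathbb{C}=2^\omega\cup\{\infty\}$, where $\infty\notin 2^\omega$, every point of $2^\omega$ is isolated, and the sets $U$ with $\infty\in U$ and $\mathbb{C}\setminus U$ countable form a local base at $\infty$. Let $$\mathbb{A}=(\mathbb{C}\times D)\cup\bigcup_{x\in2^\omega}\{x\}\times K_x,$$ a subspace of $\mathbb{C}\times\beta D$, and let $R=\{\infty\}\times D\subseteq\mathbb{A}$. A subset $A$ of a space $X$ is $C$-embedded in $X$ if every continuous $f:A\to\mathbb{R}$ has a continuous extension $X\to\mathbb{R}$, and $C^*$-embedded in $X$ if every bounded continuous $f:A\to\mathbb{R}$ has a bounded continuous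 extension $X\to\mathbb{R}$. A space is realcompact if it can be embedded as a closed subset into a power of $\mathbb{R}$. Then $\mathbb{A}$ is realcompact; $R$ is a closed subset of $\mathbb{A}$ that is homeomorphic to the discrete space $\mathbb{N}$; $R$ is $C^*$-embedded in $\mathbb{A}$, and even in the subspace $R\cup(2^\omega\times\beta D)$ of $\mathbb{C}\times\beta D$; and $R$ is not $C$-embedded in $\mathbb{A}$. -/

import Mathlib

open Set Filter Topology

section Embedding

variable {X : Type*} [TopologicalSpace X]

/-- `A` is `C`-embedded in `X`: every continuous real-valued function on `A` extends continuously
to all of `X`. -/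
def IsCEmbedded (A : Set X) : Prop :=
  ∀ f : C(A, ℝ), ∃ g : C(X, ℝ), ∀ a : A, g a = f a

/-- `A` is `C*`-embedded in `X`: every bounded continuous real-valued function on `A` extends to a
bounded continuous function on all of `X`. -/
def IsCStarEmbedded (A : Set X) : Prop :=
  ∀ f : BoundedContinuousFunction A ℝ, ∃ g : BoundedContinuousFunction X ℝ, ∀ a : A, g a = f a

end Embedding

/-- A space is realcompact if it embeds as a closed subset into a power of the real line. -/
def IsRealcompact.{u} (X : Type u) [TopologicalSpace X] : Prop :=
  ∃ (ι : Type u) (f : X → ι → ℝ), IsClosedEmbedding f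

namespace TreePlank

/-- The Cantor set `2^ω`, used as the set of branches of the binary tree. -/
abbrev Branch : Type := ℕ → Bool

/-- The tree `D = 2^{<ω}` of finite binary sequences. -/
def Tree : Type := List Bool

/-- The tree carries the discrete topology. -/
instance : TopologicalSpace Tree := ⊥

instance : DiscreteTopology Tree := ⟨rfl⟩

/-- The list of entries of an element of the tree. -/
def Tree.toList (s : Tree) : List Bool := s

/-- The underlying set of `cD`, the disjoint union of `D` and `2^ω`. -/
inductive CTree : Type
  | node (s : Tree) : CTree
  | branch (x : Branch) : CTree

/-- The `i`-th entry of a finite or infinite binary sequence; `none` if there is no such entry. -/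
def CTree.entry : CTree → ℕ → Option Bool
  | .node s, i => s.toList[i]?
  | .branch x, i => some (x i)

/-- The wedge `U(x, n)`: all finite and infinite sequences that extend `x ↾ n`. -/
def wedge (x : Branch) (n : ℕ) : Set CTree :=
  {p | ∀ i < n, p.entry i = some (x i)}

theorem wedge_anti (x : Branch) {m n : ℕ} (h : m ≤ n) : wedge x n ⊆ wedge x m :=
  fun _ hp i hi => hp i (hi.trans_le h)

/-- In `cD` the points of `D` are isolated and the wedges `U(x, n)` form a local base at the
branch `x`. -/
instance : TopologicalSpace CTree where
  IsOpen S := ∀ x : Branch, CTree.branch x ∈ S → ∃ n, wedge x n ⊆ S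
  isOpen_univ _ _ := ⟨0, subset_univ _⟩
  isOpen_inter S T hS hT x hx := by
    obtain ⟨m, hm⟩ := hS x hx.1
    obtain ⟨n, hn⟩ := hT x hx.2
    exact ⟨max m n, subset_inter ((wedge_anti x (le_max_left m n)).trans hm)
      ((wedge_anti x (le_max_right m n)).trans hn)⟩
  isOpen_sUnion 𝒮 h𝒮 x := by
    rintro ⟨S, hS, hx⟩
    obtain ⟨n, hn⟩ := h𝒮 S hS x hx
    exact ⟨n, hn.trans (subset_sUnion_of_mem hS)⟩

theorem CTree.isOpen_iff {S : Set CTree} :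
    IsOpen S ↔ ∀ x : Branch, CTree.branch x ∈ S → ∃ n, wedge x n ⊆ S := Iff.rfl

theorem branch_mem_wedge (x : Branch) (n : ℕ) : CTree.branch x ∈ wedge x n :=
  fun _ _ => rfl

theorem isOpen_wedge (x : Branch) (n : ℕ) : IsOpen (wedge x n) := by
  intro y hy
  refine ⟨n, fun p hp i hi => ?_⟩
  rw [hp i hi]
  exact hy i hi

theorem isOpen_singleton_node (s : Tree) : IsOpen {CTree.node s} := by
  intro x hx
  simp at hx

theorem node_notMem_wedge (s : Tree) (x : Branch) :
    CTree.node s ∉ wedge x (s.toList.length + 1) := by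
  intro h
  have h1 := h s.toList.length (Nat.lt_succ_self _)
  simp [CTree.entry] at h1

theorem isOpen_compl_singleton_node (s : Tree) : IsOpen ({CTree.node s}ᶜ : Set CTree) := by
  intro x _
  refine ⟨s.toList.length + 1, fun p hp h => ?_⟩
  rw [mem_singleton_iff] at h
  exact node_notMem_wedge s x (h ▸ hp)

instance : T2Space CTree := by
  refine ⟨fun p q hpq => ?_⟩
  rcases p with s | x
  · exact ⟨_, _, isOpen_singleton_node s, isOpen_compl_singleton_node s, rfl, hpq.symm,
      disjoint_compl_right⟩
  rcases q with t | y
  · exact ⟨_, _, isOpen_compl_singleton_node t, isOpen_singleton_node t, hpq, rfl,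
      disjoint_compl_left⟩
  have hxy : x ≠ y := fun h => hpq (h ▸ rfl)
  obtain ⟨i, hi⟩ := Function.ne_iff.mp hxy
  refine ⟨_, _, isOpen_wedge x (i + 1), isOpen_wedge y (i + 1), branch_mem_wedge _ _,
    branch_mem_wedge _ _, disjoint_left.mpr fun p hp hq => hi ?_⟩
  have h1 := hp i (Nat.lt_succ_self i)
  rw [hq i (Nat.lt_succ_self i)] at h1
  exact (Option.some.inj h1).symm

instance : CompactSpace CTree := by
  refine ⟨isCompact_iff_ultrafilter_le_nhds.mpr fun F _ => ?_⟩
  have key : ∀ i, ∃ a : Option Bool, {p : CTree | p.entry i = a} ∈ F := by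
    intro i
    obtain ⟨a, ha⟩ := (F.map fun p : CTree => p.entry i).eq_pure_of_finite
    refine ⟨a, ?_⟩
    have h1 : ({a} : Set (Option Bool)) ∈ F.map fun p : CTree => p.entry i := by
      rw [ha]; exact rfl
    exact h1
  choose a ha using key
  by_cases hn : ∃ n, a n = none
  · obtain ⟨n, hn⟩ := hn
    have hfin : ({p : CTree | p.entry n = a n}).Finite := by
      refine ((List.finite_length_le Bool n).image fun s : List Bool => CTree.node s).subset ?_
      rintro (s | x) hp
      · refine ⟨s, ?_, rfl⟩
        rw [hn] at hp
        exact List.getElem?_eq_none_iff.mp hp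
      · rw [hn] at hp
        simp [CTree.entry] at hp
    obtain ⟨p, _, hp⟩ := Ultrafilter.eq_pure_of_finite_mem hfin (ha n)
    refine ⟨p, mem_univ _, ?_⟩
    rw [hp]
    exact pure_le_nhds p
  · push Not at hn
    have hx : ∀ n, ∃ b, a n = some b := fun n => Option.ne_none_iff_exists'.mp (hn n)
    choose x hx using hx
    refine ⟨.branch x, mem_univ _, fun S hS => ?_⟩
    obtain ⟨T, hTS, hT, hxT⟩ := mem_nhds_iff.mp hS
    obtain ⟨n, hn'⟩ := hT x hxT
    refine mem_of_superset ?_ (hn'.trans hTS)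
    have h1 : (⋂ i ∈ Finset.range n, {p : CTree | p.entry i = a i}) ∈ (F : Filter CTree) :=
      (biInter_finset_mem _).mpr fun i _ => ha i
    refine mem_of_superset h1 fun p hp i hi => ?_
    have h2 := mem_iInter₂.mp hp i (Finset.mem_range.mpr hi)
    exact h2.trans (hx i)

/-- The Čech-Stone compactification `βD` of the discrete space `D`. -/
abbrev BetaTree : Type := StoneCech Tree

/-- The map `e : βD → cD`, the continuous extension of the identity of `D`. -/
noncomputable def collapse : BetaTree → CTree :=
  stoneCechExtend (continuous_of_discreteTopology : Continuous CTree.node)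

/-- `D` as a subset of `βD`. -/
def treeInBeta : Set BetaTree := range stoneCechUnit

/-- The fibre `K_x` of `e` over the branch `x`, a subset of `D* = βD \ D`. -/
def fibre (x : Branch) : Set BetaTree := {u | u ∉ treeInBeta ∧ collapse u = CTree.branch x}

/-- The underlying set of `ℂ`: the set `2^ω` with one extra point `∞`. -/
inductive CocountableLine : Type
  | pt (x : Branch) : CocountableLine
  | infty : CocountableLine

/-- In `ℂ` the points of `2^ω` are isolated and the neighbourhoods of `∞` are the sets containing
`∞` whose complement is countable. -/
instance : TopologicalSpace CocountableLine where
  IsOpen S := CocountableLine.infty ∈ S → Sᶜ.Countable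
  isOpen_univ _ := by simp
  isOpen_inter S T hS hT h := by
    rw [compl_inter]
    exact (hS h.1).union (hT h.2)
  isOpen_sUnion 𝒮 h𝒮 := by
    rintro ⟨S, hS, h⟩
    exact (h𝒮 S hS h).mono (compl_subset_compl.mpr (subset_sUnion_of_mem hS))

/-- The plank `𝔸 = (ℂ × D) ∪ ⋃ₓ {x} × K_x`, a subspace of `ℂ × βD`. -/
def plank : Set (CocountableLine × BetaTree) :=
  univ ×ˢ treeInBeta ∪ ⋃ x : Branch, {CocountableLine.pt x} ×ˢ fibre x

/-- The right-hand side `R = {∞} × D`. -/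
def rightSide : Set (CocountableLine × BetaTree) :=
  {CocountableLine.infty} ×ˢ treeInBeta

/-- The larger subspace `R ∪ (2^ω × βD)` of `ℂ × βD`. -/
def bigPlank : Set (CocountableLine × BetaTree) :=
  rightSide ∪ range CocountableLine.pt ×ˢ univ

theorem rightSide_subset_plank : rightSide ⊆ plank :=
  fun _ hp => Or.inl ⟨mem_univ _, hp.2⟩

theorem plank_subset_bigPlank : plank ⊆ bigPlank := by
  rintro ⟨(x | _), u⟩ hp
  · exact Or.inr ⟨⟨x, rfl⟩, mem_univ _⟩
  · rcases hp with hp | hp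
    · exact Or.inl ⟨rfl, hp.2⟩
    · obtain ⟨x, hx, _⟩ := mem_iUnion.mp hp
      cases hx

end TreePlank

/-! Realcompactness: `isRealcompact_of_ultrafilter` reduces it to convergence of ultrafilters along
which all continuous real functions converge. In `plank` the first coordinate then converges in `ℂ`
and the second in the compact `βD`. A limit `(c, u)` outside the plank has `u ∈ K_x` and `c ≠ x`,
and then the continuous function `plankLevel x` diverges to infinity.

Bounded functions on `R` are bounded functions on `D`; they extend over `βD` and pull back along the
projection.

The length function on `R` does not extend. An extension agrees on each row with its value at `∞`
off a countable set. As `D` is countable and `2^ω` is not, some column `x` carries the length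
function on all of `D`. It is unbounded along the branch `x`, contradicting continuity at a point of
`{x} × K_x`. -/

namespace TreePlank

/-! ### Wedges and splitting levels in `cD` -/

section CTree

instance : Uncountable Branch := by
  refine uncountable_iff_forall_not_surjective.mpr fun f hf => ?_
  obtain ⟨n, hn⟩ := hf fun n => !f n n
  simpa using congrFun hn n

theorem isClosed_wedge (x : Branch) (n : ℕ) : IsClosed (wedge x n) := by
  refine ⟨fun z hz => ⟨n, fun p hp hpx => hz fun i hi => ?_⟩⟩
  rw [← hpx i hi, hp i hi]
  rfl

theorem CTree.nhds_branch_hasBasis (x : Branch) :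
    (𝓝 (CTree.branch x)).HasBasis (fun _ : ℕ => True) (wedge x) := by
  refine ⟨fun S => ⟨fun hS => ?_, fun ⟨n, _, hn⟩ => ?_⟩⟩
  · obtain ⟨T, hTS, hT, hxT⟩ := mem_nhds_iff.mp hS
    obtain ⟨n, hn⟩ := hT x hxT
    exact ⟨n, trivial, hn.trans hTS⟩
  · exact mem_of_superset ((isOpen_wedge x n).mem_nhds (branch_mem_wedge x n)) hn

theorem exists_notMem_wedge {x : Branch} {p : CTree} (hp : p ≠ .branch x) :
    ∃ n, p ∉ wedge x n := by
  rcases p with s | y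
  · exact ⟨_, node_notMem_wedge s x⟩
  · have hyx : y ≠ x := fun h => hp (h ▸ rfl)
    obtain ⟨i, hi⟩ := Function.ne_iff.mp hyx
    exact ⟨i + 1, fun h => hi (Option.some.inj (h i (Nat.lt_succ_self i)))⟩

/-- The least `n` such that `p` is not in the wedge `U(x, n)`, and `0` if `p = x`. -/
noncomputable def splitLevel (x : Branch) (p : CTree) : ℕ :=
  sInf {n | p ∉ wedge x n}

theorem lt_splitLevel {x : Branch} {p : CTree} {n : ℕ} (hp : p ≠ .branch x) (h : p ∈ wedge x n) :
    n < splitLevel x p := by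
  have h1 : p ∉ wedge x (splitLevel x p) := Nat.sInf_mem (exists_notMem_wedge hp)
  by_contra! h2
  exact h1 (wedge_anti x h2 h)

/-- Finitely many wedge conditions determine the level, and each persists near `p` because wedges
are clopen. -/
theorem splitLevel_eventually_eq {x : Branch} {p : CTree} (hp : p ≠ .branch x) :
    ∀ᶠ q in 𝓝 p, splitLevel x q = splitLevel x p := by
  have h1 : p ∉ wedge x (splitLevel x p) := Nat.sInf_mem (exists_notMem_wedge hp)
  have h2 : ∀ n < splitLevel x p, p ∈ wedge x n := fun n hn => by
    by_contra h
    exact Nat.notMem_of_lt_sInf hn h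
  have h3 : ∀ᶠ q in 𝓝 p, ∀ n ∈ Finset.range (splitLevel x p), q ∈ wedge x n :=
    (Filter.eventually_all_finset _).mpr fun n hn =>
      (isOpen_wedge x n).mem_nhds (h2 n (Finset.mem_range.mp hn))
  filter_upwards [(isClosed_wedge x _).isOpen_compl.mem_nhds h1, h3] with q hq1 hq2
  refine le_antisymm (Nat.sInf_le hq1) (le_csInf ⟨_, hq1⟩ fun n hn => ?_)
  by_contra! hlt
  exact hn (hq2 n (Finset.mem_range.mpr hlt))

/-- The initial segment `x ↾ n` of a branch. -/
def Branch.restrict (x : Branch) (n : ℕ) : Tree := List.ofFn fun i : Fin n => x i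

theorem Branch.length_restrict (x : Branch) (n : ℕ) : (Branch.restrict x n).toList.length = n :=
  List.length_ofFn

theorem Branch.tendsto_node_restrict (x : Branch) :
    Tendsto (fun n => CTree.node (Branch.restrict x n)) atTop (𝓝 (.branch x)) := by
  refine (CTree.nhds_branch_hasBasis x).tendsto_right_iff.mpr fun m _ => ?_
  filter_upwards [eventually_ge_atTop m] with n hn i hi
  have hin : i < n := hi.trans_le hn
  simp [CTree.entry, Branch.restrict, Tree.toList, hin]

end CTree

/-! ### The fibres of `βD → cD` -/

section BetaTree

instance : Countable Tree := inferInstanceAs (Countable (List Bool))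

instance : Infinite Tree := inferInstanceAs (Infinite (List Bool))

theorem continuous_collapse : Continuous collapse := continuous_stoneCechExtend _

theorem collapse_stoneCechUnit (s : Tree) : collapse (stoneCechUnit s) = .node s :=
  stoneCechExtend_stoneCechUnit _ s

/-- A second point over `node s` would have an open neighbourhood over `node s` missing `s`, yet
this must meet the dense set `D`, on which `collapse` is the identity. -/
theorem collapse_eq_node_iff {u : BetaTree} {s : Tree} :
    collapse u = .node s ↔ u = stoneCechUnit s := by
  refine ⟨fun h => ?_, fun h => h ▸ collapse_stoneCechUnit s⟩
  by_contra hu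
  have hopen : IsOpen (collapse ⁻¹' {.node s} ∩ {stoneCechUnit s}ᶜ) :=
    ((isOpen_singleton_node s).preimage continuous_collapse).inter isOpen_compl_singleton
  obtain ⟨t, ht, hts⟩ := denseRange_stoneCechUnit.exists_mem_open hopen ⟨u, h, hu⟩
  rw [mem_preimage, collapse_stoneCechUnit, mem_singleton_iff] at ht
  cases ht
  exact hts rfl

theorem stoneCechUnit_injective : Function.Injective (stoneCechUnit : Tree → BetaTree) := by
  intro s t h
  have h1 := collapse_eq_node_iff.mpr h
  rw [collapse_stoneCechUnit] at h1
  exact CTree.node.inj h1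

theorem isOpen_singleton_stoneCechUnit (s : Tree) :
    IsOpen {(stoneCechUnit s : BetaTree)} := by
  have h : {(stoneCechUnit s : BetaTree)} = collapse ⁻¹' {.node s} := by
    ext u
    exact collapse_eq_node_iff.symm
  rw [h]
  exact (isOpen_singleton_node s).preimage continuous_collapse

theorem exists_collapse_eq_branch {u : BetaTree} (hu : u ∉ treeInBeta) :
    ∃ x, collapse u = .branch x := by
  rcases h : collapse u with s | x
  · exact absurd ⟨s, (collapse_eq_node_iff.mp h).symm⟩ hu
  · exact ⟨x, rfl⟩

theorem mem_fibre_of_collapse_eq {u : BetaTree} {x : Branch} (h : collapse u = .branch x) :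
    u ∈ fibre x := by
  refine ⟨?_, h⟩
  rintro ⟨s, rfl⟩
  rw [collapse_stoneCechUnit] at h
  cases h

/-- The length of a point of `D`, with the value `0` on `D*`. -/
noncomputable def treeLength (u : BetaTree) : ℕ :=
  match collapse u with
  | .node s => s.toList.length
  | .branch _ => 0

theorem treeLength_stoneCechUnit (s : Tree) : treeLength (stoneCechUnit s) = s.toList.length := by
  simp [treeLength, collapse_stoneCechUnit]

end BetaTree

/-! ### Continuous functions and ultrafilters on `ℂ` -/

namespace CocountableLine

theorem isOpen_of_infty_notMem {S : Set CocountableLine} (h : infty ∉ S) : IsOpen S :=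
  fun h' => absurd h' h

theorem isOpen_of_countable_compl {S : Set CocountableLine} (h : Sᶜ.Countable) : IsOpen S :=
  fun _ => h

theorem isClopen_of_countable {S : Set CocountableLine} (hS : S.Countable) (h : infty ∉ S) :
    IsClopen S :=
  ⟨⟨isOpen_of_countable_compl (by rwa [compl_compl])⟩, isOpen_of_infty_notMem h⟩

theorem isClopen_singleton_pt (x : Branch) : IsClopen {pt x} :=
  isClopen_of_countable (countable_singleton _) (by simp)

/-- The value at `∞` is the intersection of countably many balls, and the preimage of each is
cocountable. -/
theorem countable_ne_infty {h : CocountableLine → ℝ} (hh : Continuous h) :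
    {c | h c ≠ h infty}.Countable := by
  have h1 : ∀ n : ℕ, (h ⁻¹' Metric.ball (h infty) (1 / (n + 1)))ᶜ.Countable := fun n =>
    Metric.isOpen_ball.preimage hh (Metric.mem_ball_self (by positivity))
  refine (countable_iUnion h1).mono fun c hc => ?_
  obtain ⟨n, hn⟩ := exists_nat_one_div_lt (dist_pos.mpr hc)
  exact mem_iUnion.mpr ⟨n, fun h2 => absurd (Metric.mem_ball.mp h2) hn.not_gt⟩

/-- An ultrafilter on `ℂ` along which every continuous real-valued function converges is itself
convergent. -/
theorem exists_le_nhds (F : Ultrafilter CocountableLine)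
    (hF : ∀ h : C(CocountableLine, ℝ), ∃ r, Tendsto h (F : Filter CocountableLine) (𝓝 r)) :
    ∃ c, (F : Filter CocountableLine) ≤ 𝓝 c := by
  by_cases hinf : (F : Filter _) ≤ 𝓝 infty
  · exact ⟨_, hinf⟩
  obtain ⟨S, hS, hSF⟩ := Filter.not_le.mp hinf
  obtain ⟨T, hTS, hT, hinfT⟩ := mem_nhds_iff.mp hS
  have hTF : Tᶜ ∈ F := Ultrafilter.compl_mem_iff_notMem.mpr fun h => hSF (mem_of_superset h hTS)
  have hcount : (Tᶜ).Countable := hT hinfT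
  obtain ⟨k, hk⟩ := countable_iff_exists_injOn.mp hcount
  classical
  -- Injective with integer values on the countable clopen set `Tᶜ`, which belongs to `F`;
  -- convergence of `h` will force `F` to be principal.
  let h : CocountableLine → ℝ := fun c => if c ∈ T then 0 else k c
  have hcont : Continuous h := by
    have hclopen : IsClopen T := by
      simpa using (isClopen_of_countable hcount (by simpa using hinfT)).compl
    refine continuous_iff_continuousAt.mpr fun c => ?_
    by_cases hc : c ∈ T
    · refine (continuousAt_const (y := (0 : ℝ))).congr ?_
      filter_upwards [hclopen.isOpen.mem_nhds hc] with d hd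
      simp [h, hd]
    · have hopen : IsOpen {c} := isOpen_of_infty_notMem fun hi => hc (hi ▸ hinfT)
      refine (continuousAt_const (y := h c)).congr ?_
      filter_upwards [hopen.mem_nhds rfl] with d hd
      rw [mem_singleton_iff.mp hd]
  obtain ⟨r, hr⟩ := hF ⟨h, hcont⟩
  have hball : {c | dist (h c) r < 1 / 2} ∈ F :=
    hr (Metric.ball_mem_nhds r (by norm_num : (0 : ℝ) < 1 / 2))
  have hsub : (Tᶜ ∩ {c | dist (h c) r < 1 / 2}).Subsingleton := by
    rintro c ⟨hc, hcr⟩ d ⟨hd, hdr⟩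
    refine hk hc hd ?_
    have h1 : dist (h c) (h d) < 1 := by
      have := dist_triangle_right (h c) (h d) r
      have h2 : dist (h c) r < 1 / 2 := hcr
      have h3 : dist (h d) r < 1 / 2 := hdr
      linarith
    simp only [h, if_neg hc, if_neg hd] at h1
    rw [Nat.dist_cast_real] at h1
    exact Nat.pairwise_one_le_dist.eq h1.not_ge
  obtain ⟨c, -, hc⟩ := Ultrafilter.eq_pure_of_finite_mem hsub.finite (inter_mem hTF hball)
  exact ⟨c, hc ▸ pure_le_nhds c⟩

end CocountableLine

/-! ### Ultrafilters and separation of points in the plank -/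

section Plank

theorem mk_stoneCechUnit_mem_plank (c : CocountableLine) (s : Tree) :
    (c, stoneCechUnit s) ∈ plank :=
  Or.inl ⟨mem_univ _, s, rfl⟩

theorem mk_pt_mem_plank {x : Branch} {u : BetaTree} (h : collapse u = .branch x) :
    (CocountableLine.pt x, u) ∈ plank :=
  Or.inr (mem_iUnion.mpr ⟨x, rfl, mem_fibre_of_collapse_eq h⟩)

theorem eq_pt_of_mem_plank {p : CocountableLine × BetaTree} (hp : p ∈ plank) {x : Branch}
    (h : collapse p.2 = .branch x) : p.1 = .pt x := by
  rcases hp with ⟨-, hp⟩ | hp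
  · exact absurd hp (mem_fibre_of_collapse_eq h).1
  · obtain ⟨y, hy, -, hyu⟩ := mem_iUnion.mp hp
    rw [h] at hyu
    cases hyu
    exact hy

/-- The function on the plank that vanishes on the column over `x` and elsewhere measures how
closely the second coordinate approaches `x`. -/
noncomputable def plankLevel (x : Branch) (p : plank) : ℝ :=
  open Classical in if p.1.1 = .pt x then 0 else splitLevel x (collapse p.1.2)

/-- The function is locally constant: the column over `x` is clopen, and off it no point of the
plank lies over the branch `x`, so the splitting level is locally constant there. -/
theorem continuous_plankLevel (x : Branch) : Continuous (plankLevel x) := by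
  refine continuous_iff_continuousAt.mpr fun p => ?_
  have hfst : Continuous fun q : plank => q.1.1 := continuous_fst.comp continuous_subtype_val
  have hsnd : Continuous fun q : plank => collapse q.1.2 :=
    continuous_collapse.comp (continuous_snd.comp continuous_subtype_val)
  have hclopen := CocountableLine.isClopen_singleton_pt x
  refine (continuousAt_const (y := plankLevel x p)).congr ?_
  by_cases hp : p.1.1 = .pt x
  · filter_upwards [(hclopen.isOpen.preimage hfst).mem_nhds hp] with q hq
    have hq' : q.1.1 = .pt x := hq
    simp [plankLevel, hp, hq']
  · have hne : collapse p.1.2 ≠ .branch x := fun h => hp (eq_pt_of_mem_plank p.2 h)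
    filter_upwards [(hclopen.compl.isOpen.preimage hfst).mem_nhds hp,
      hsnd.continuousAt.eventually (splitLevel_eventually_eq hne)] with q hq hq2
    have hq' : q.1.1 ≠ .pt x := hq
    simp [plankLevel, hp, hq', hq2]

theorem tendsto_plankLevel_atTop {x : Branch} {F : Filter plank}
    (h1 : ∀ᶠ p in F, p.1.1 ≠ .pt x)
    (h2 : Tendsto (fun p : plank => collapse p.1.2) F (𝓝 (.branch x))) :
    Tendsto (plankLevel x) F atTop := by
  refine tendsto_atTop.mpr fun r => ?_
  obtain ⟨n, hn⟩ := exists_nat_ge r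
  filter_upwards [h1, h2 ((isOpen_wedge x n).mem_nhds (branch_mem_wedge x n))] with p hp hpn
  have hne : collapse p.1.2 ≠ .branch x := fun h => hp (eq_pt_of_mem_plank p.2 h)
  have := lt_splitLevel hne hpn
  simp only [plankLevel, if_neg hp]
  exact hn.trans (by exact_mod_cast this.le)

theorem plank_exists_le_nhds (F : Ultrafilter plank)
    (hF : ∀ h : C(plank, ℝ), ∃ r, Tendsto h (F : Filter plank) (𝓝 r)) :
    ∃ p, (F : Filter plank) ≤ 𝓝 p := by
  have hfst : Continuous fun q : plank => q.1.1 := continuous_fst.comp continuous_subtype_val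
  obtain ⟨c, hc⟩ := CocountableLine.exists_le_nhds (F.map fun q : plank => q.1.1)
    fun h => hF (h.comp ⟨_, hfst⟩)
  replace hc : Tendsto (fun q : plank => q.1.1) F (𝓝 c) := hc
  obtain ⟨u, -, hu⟩ := isCompact_univ.ultrafilter_le_nhds (F.map fun q : plank => q.1.2) (by simp)
  replace hu : Tendsto (fun q : plank => q.1.2) F (𝓝 u) := hu
  by_cases hmem : (c, u) ∈ plank
  · refine ⟨⟨_, hmem⟩, ?_⟩
    have h1 : Tendsto (fun q : plank => q.1) F (𝓝 (c, u)) := hc.prodMk_nhds hu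
    rw [nhds_subtype]
    exact h1.le_comap
  have huD : u ∉ treeInBeta := fun h => hmem (Or.inl ⟨mem_univ _, h⟩)
  obtain ⟨x, hx⟩ := exists_collapse_eq_branch huD
  have hcx : c ≠ .pt x := fun h => hmem (h ▸ mk_pt_mem_plank hx)
  obtain ⟨r, hr⟩ := hF ⟨_, continuous_plankLevel x⟩
  have h1 : ∀ᶠ p : plank in F, p.1.1 ≠ .pt x :=
    hc ((CocountableLine.isClopen_singleton_pt x).compl.isOpen.mem_nhds hcx)
  have h2 : Tendsto (fun p : plank => collapse p.1.2) F (𝓝 (.branch x)) :=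
    hx ▸ (continuous_collapse.tendsto u).comp hu
  exact absurd hr (not_tendsto_nhds_of_tendsto_atTop (tendsto_plankLevel_atTop h1 h2) r)

/-- Indicators of the clopen columns separate first coordinates; Urysohn functions on `βD` separate
second ones. -/
theorem plank_separates_points {p q : plank} (h : ∀ f : C(plank, ℝ), f p = f q) : p = q := by
  have hfst : Continuous fun q : plank => q.1.1 := continuous_fst.comp continuous_subtype_val
  have hsnd : Continuous fun q : plank => q.1.2 := continuous_snd.comp continuous_subtype_val
  have hpt : ∀ x, p.1.1 = .pt x ↔ q.1.1 = .pt x := fun x => by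
    have hclopen := (CocountableLine.isClopen_singleton_pt x).preimage hfst
    classical
    have h1 := h ⟨_, continuous_one.indicator
      (s := (fun q : plank => q.1.1) ⁻¹' {.pt x}) (by simp [hclopen.frontier_eq])⟩
    simp only [ContinuousMap.coe_mk, indicator_apply, mem_preimage, mem_singleton_iff,
      Pi.one_apply] at h1
    split_ifs at h1 <;> simp_all
  refine Subtype.ext (Prod.ext ?_ ?_)
  · rcases hp : p.1.1 with x | _
    · exact ((hpt x).mp hp).symm
    · rcases hq : q.1.1 with x | _
      · exact absurd ((hpt x).mpr hq) (by simp [hp])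
      · rfl
  · by_contra hne
    obtain ⟨f, hf0, hf1, -⟩ := exists_continuous_zero_one_of_isClosed
      (isClosed_singleton (x := p.1.2)) (isClosed_singleton (x := q.1.2)) (by simpa using hne)
    have h1 : f p.1.2 = f q.1.2 := h (f.comp ⟨_, hsnd⟩)
    have h2 := hf0 (mem_singleton p.1.2)
    have h3 := hf1 (mem_singleton q.1.2)
    simp_all

end Plank

end TreePlank

/-- A space is realcompact if its continuous real-valued functions separate points and every
ultrafilter along which all of them converge is convergent. -/
theorem isRealcompact_of_ultrafilter {X : Type*} [TopologicalSpace X]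
    (hsep : ∀ x y : X, (∀ f : C(X, ℝ), f x = f y) → x = y)
    (hconv : ∀ F : Ultrafilter X, (∀ f : C(X, ℝ), ∃ r, Tendsto f (F : Filter X) (𝓝 r)) →
      ∃ x, (F : Filter X) ≤ 𝓝 x) : IsRealcompact X := by
  have hcont : Continuous fun (x : X) (f : C(X, ℝ)) => f x :=
    continuous_pi fun f => f.continuous
  have hproper : IsProperMap fun (x : X) (f : C(X, ℝ)) => f x := by
    refine isProperMap_iff_ultrafilter.mpr ⟨hcont, fun F y hy => ?_⟩
    obtain ⟨x, hx⟩ := hconv F fun f => ⟨y f, tendsto_pi_nhds.mp hy f⟩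
    exact ⟨x, tendsto_nhds_unique (hcont.continuousAt.mono_left hx) hy, hx⟩
  exact ⟨C(X, ℝ), _, .of_continuous_injective_isClosedMap hcont
    (fun x y h => hsep x y fun f => congrFun h f) hproper.isClosedMap⟩

namespace TreePlank

/-! ### Embedding properties of `R` -/

section RightSide

variable {Y : Set (CocountableLine × BetaTree)}

theorem isClosed_rightSide : IsClosed ((↑) ⁻¹' rightSide : Set plank) := by
  have h : ((↑) ⁻¹' rightSide : Set plank) = (fun p : plank => p.1.1) ⁻¹' {.infty} := by
    ext p
    refine ⟨fun h => h.1, fun h => ⟨h, ?_⟩⟩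
    by_contra hu
    obtain ⟨x, hx⟩ := exists_collapse_eq_branch hu
    have h1 := eq_pt_of_mem_plank p.2 hx
    rw [mem_preimage, mem_singleton_iff, h1] at h
    cases h
  rw [h]
  have hclosed : IsClosed {CocountableLine.infty} :=
    ⟨CocountableLine.isOpen_of_infty_notMem (by simp)⟩
  exact hclosed.preimage (continuous_fst.comp continuous_subtype_val)

/-- The point of `R` with a given second coordinate, in a space that includes `R`. -/
def rightPoint (hY : rightSide ⊆ Y) (s : Tree) : ((↑) ⁻¹' rightSide : Set Y) :=
  ⟨⟨(.infty, stoneCechUnit s), hY ⟨rfl, s, rfl⟩⟩, rfl, s, rfl⟩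

theorem rightPoint_bijective (hY : rightSide ⊆ Y) : Function.Bijective (rightPoint hY) := by
  refine ⟨fun s t h => stoneCechUnit_injective ?_, ?_⟩
  · exact congrArg (fun p : ((↑) ⁻¹' rightSide : Set Y) => p.1.1.2) h
  · rintro ⟨⟨⟨c, u⟩, hp⟩, hc, s, hs⟩
    refine ⟨s, Subtype.ext (Subtype.ext (Prod.ext ?_ hs))⟩
    exact hc.symm

theorem discreteTopology_rightSide (hY : rightSide ⊆ Y) :
    DiscreteTopology ((↑) ⁻¹' rightSide : Set Y) := by
  refine discreteTopology_iff_isOpen_singleton.mpr fun p => ?_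
  obtain ⟨s, rfl⟩ := (rightPoint_bijective hY).2 p
  have h : {rightPoint hY s} =
      (fun p : ((↑) ⁻¹' rightSide : Set Y) => p.1.1.2) ⁻¹' {stoneCechUnit s} := by
    ext p
    obtain ⟨t, rfl⟩ := (rightPoint_bijective hY).2 p
    simp only [mem_singleton_iff, mem_preimage, (rightPoint_bijective hY).1.eq_iff]
    exact stoneCechUnit_injective.eq_iff.symm
  rw [h]
  exact (isOpen_singleton_stoneCechUnit s).preimage
    (continuous_snd.comp (continuous_subtype_val.comp continuous_subtype_val))

theorem nonempty_rightSide_homeomorph_nat (hY : rightSide ⊆ Y) :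
    Nonempty (((↑) ⁻¹' rightSide : Set Y) ≃ₜ ℕ) := by
  have := discreteTopology_rightSide hY
  obtain ⟨e⟩ := nonempty_equiv_of_countable (α := Tree) (β := ℕ)
  exact ⟨{ toEquiv := (Equiv.ofBijective _ (rightPoint_bijective hY)).symm.trans
            e
           continuous_toFun := continuous_of_discreteTopology
           continuous_invFun := continuous_of_discreteTopology }⟩

/-- The extension ignores the first coordinate, so it works on every `Y` containing `R`. Boundedness
supplies the compact target that Stone–Čech extension needs. -/
theorem isCStarEmbedded_rightSide (hY : rightSide ⊆ Y) :
    IsCStarEmbedded ((↑) ⁻¹' rightSide : Set Y) := by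
  intro f
  let φ : Tree → Icc (-‖f‖) ‖f‖ := fun s =>
    ⟨f (rightPoint hY s), abs_le.mp (f.norm_coe_le_norm _)⟩
  have hφ : Continuous φ := continuous_of_discreteTopology
  let g : Y → ℝ := fun p => (stoneCechExtend hφ p.1.2 : Icc (-‖f‖) ‖f‖)
  have hg : Continuous g := continuous_subtype_val.comp
    ((continuous_stoneCechExtend hφ).comp (continuous_snd.comp continuous_subtype_val))
  refine ⟨.ofNormedAddCommGroup g hg ‖f‖ fun p => abs_le.mpr (stoneCechExtend hφ p.1.2).2,
    fun a => ?_⟩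
  obtain ⟨s, rfl⟩ := (rightPoint_bijective hY).2 a
  exact congrArg Subtype.val (stoneCechExtend_stoneCechUnit hφ s)

theorem not_isCEmbedded_rightSide : ¬ IsCEmbedded ((↑) ⁻¹' rightSide : Set plank) := by
  intro hC
  have := discreteTopology_rightSide rightSide_subset_plank
  obtain ⟨g, hg⟩ := hC ⟨fun a => treeLength a.1.1.2, continuous_of_discreteTopology⟩
  let row (s : Tree) (c : CocountableLine) : ℝ := g ⟨(c, stoneCechUnit s),
    mk_stoneCechUnit_mem_plank c s⟩
  have hrow (s : Tree) : Continuous (row s) :=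
    g.continuous.comp (Continuous.subtype_mk (by fun_prop) _)
  have hinfty (s : Tree) : row s .infty = s.toList.length := by
    rw [← treeLength_stoneCechUnit]
    exact hg (rightPoint rightSide_subset_plank s)
  have hcount : (⋃ s, CocountableLine.pt ⁻¹' {c | row s c ≠ row s .infty}).Countable :=
    countable_iUnion fun s => (CocountableLine.countable_ne_infty (hrow s)).preimage
      fun x y h => CocountableLine.pt.inj h
  obtain ⟨x, hx⟩ : ∃ x, x ∉ ⋃ s, CocountableLine.pt ⁻¹' {c | row s c ≠ row s .infty} := by
    by_contra! h
    exact not_countable_univ (α := Branch) (hcount.mono fun x _ => h x)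
  replace hx (s : Tree) : row s (.pt x) = s.toList.length := by
    by_contra h
    exact hx (mem_iUnion.mpr ⟨s, by rwa [mem_preimage, mem_ofPred_eq, hinfty]⟩)
  -- A cluster point of the nodes `x ↾ n`; it lies over `x`, so `(x, u)` belongs to the plank.
  obtain ⟨u, -, hu⟩ := isCompact_univ.ultrafilter_le_nhds
    ((hyperfilter ℕ).map fun n => (stoneCechUnit (Branch.restrict x n) : BetaTree)) (by simp)
  replace hu : Tendsto (fun n => (stoneCechUnit (Branch.restrict x n) : BetaTree))
    (hyperfilter ℕ) (𝓝 u) := hu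
  have hle : (hyperfilter ℕ : Filter ℕ) ≤ atTop := Nat.hyperfilter_le_atTop
  have hux : collapse u = .branch x := by
    refine tendsto_nhds_unique ((continuous_collapse.tendsto u).comp hu) ?_
    simpa only [Function.comp_def, collapse_stoneCechUnit] using
      (Branch.tendsto_node_restrict x).mono_left hle
  have hcol : Tendsto (fun n => row (Branch.restrict x n) (.pt x)) (hyperfilter ℕ)
      (𝓝 (g ⟨_, mk_pt_mem_plank hux⟩)) := by
    refine (g.continuous.tendsto _).comp ?_
    rw [tendsto_subtype_rng]
    exact tendsto_const_nhds.prodMk_nhds hu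
  simp only [hx, Branch.length_restrict] at hcol
  exact not_tendsto_nhds_of_tendsto_atTop (tendsto_natCast_atTop_atTop.mono_left hle) _ hcol

end RightSide

end TreePlank

theorem mainTheorem1 :
    IsRealcompact TreePlank.plank ∧
    IsClosed ((↑) ⁻¹' TreePlank.rightSide : Set TreePlank.plank) ∧
    Nonempty (((↑) ⁻¹' TreePlank.rightSide : Set TreePlank.plank) ≃ₜ ℕ) ∧
    IsCStarEmbedded ((↑) ⁻¹' TreePlank.rightSide : Set TreePlank.plank) ∧
    IsCStarEmbedded ((↑) ⁻¹' TreePlank.rightSide : Set TreePlank.bigPlank) ∧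
    ¬ IsCEmbedded ((↑) ⁻¹' TreePlank.rightSide : Set TreePlank.plank) :=
  ⟨isRealcompact_of_ultrafilter (fun _ _ => TreePlank.plank_separates_points)
      TreePlank.plank_exists_le_nhds,
    TreePlank.isClosed_rightSide,
    TreePlank.nonempty_rightSide_homeomorph_nat TreePlank.rightSide_subset_plank,
    TreePlank.isCStarEmbedded_rightSide TreePlank.rightSide_subset_plank,
    TreePlank.isCStarEmbedded_rightSide
      (TreePlank.rightSide_subset_plank.trans TreePlank.plank_subset_bigPlank),
    TreePlank.not_isCEmbedded_rightSide⟩
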